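/- For finite groups $G,H$ and a subgroup $U\le G\times H$, let $p_1(U)\le G$ and $p_2(U)\le H$ be the projections of $U$, let $k_1(U)=\{g\in G : (g,1)\in U\}\trianglelefteq p_1(U)$, and let $q(U)=p_1(U)/k_1(U)$ be the Goursat quotient of $U$. The subgroup $U$ is a subdirect product of $G$ and $H$ if $p_1(U)=G$ and $p_2(U)=H$. It is called extensible if every homomorphism $U\to A$ extends to a homomorphism $G\times H\to A$, for every abelian group $A$ for which there is a unique set of primes $\pi$ such that, for every integer $n\ge 1$, the subgroup $\{a\in A : a^n=1\}$ is cyclic of order $n_\pi$ (the $\pi$-part of $n$). We say that $U$ satisfies condition (C) if for each prime divisor $p$ of $|q(U)|$ the Sylow $p$-subgroups of $q(U)$ are cyclic. (1) Let $G,H$ be finite groups and $U\le G\times H$ a subdirect product satisfying (C). Then $U$ is extensible. (2) Condition (C) is functorial, that is, preserved under the $\ast$-product: let $F,G,H$ be finite groups and let $U\le F\times G$ and $V\le G\times H$ be subgroups satisfying (C). Then $$U\ast V=\{(u,v)\in F\times H : \exists\, x\in G,\ (u,x)\in U \text{ and } (x,v)\in V\}$$ satisfies (C). Moreover, if $U$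 and $V$ are subdirect products, then so is $U\ast V$. -/

import Mathlib

universe w

namespace SubdirectExt

/-- The first projection `p₁(U)` of a subgroup `U ≤ G × H`. -/
def p₁ {G H : Type*} [Group G] [Group H] (U : Subgroup (G × H)) : Subgroup G :=
  U.map (MonoidHom.fst G H)

/-- The second projection `p₂(U)` of a subgroup `U ≤ G × H`. -/
def p₂ {G H : Type*} [Group G] [Group H] (U : Subgroup (G × H)) : Subgroup H :=
  U.map (MonoidHom.snd G H)

/-- The subgroup `k₁(U) = {g ∈ G | (g, 1) ∈ U}` of `G`. -/
def k₁ {G H : Type*} [Group G] [Group H] (U : Subgroup (G × H)) : Subgroup G :=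
  U.comap (MonoidHom.inl G H)

/-- `k₁(U)`, viewed inside `p₁(U)`, is normal in `p₁(U)`. -/
instance k₁_normal {G H : Type*} [Group G] [Group H] (U : Subgroup (G × H)) :
    ((k₁ U).subgroupOf (p₁ U)).Normal := by
  refine ⟨fun n hn g => ?_⟩
  obtain ⟨g, hg⟩ := g
  obtain ⟨⟨a, b⟩, hab, rfl⟩ := hg
  have h1 : ((n : G), (1 : H)) ∈ U := hn
  have h2 := U.mul_mem (U.mul_mem hab h1) (U.inv_mem hab)
  have h3 : (a, b) * ((n : G), (1 : H)) * (a, b)⁻¹ = (a * n * a⁻¹, 1) := by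
    ext <;> simp
  rw [h3] at h2
  exact h2

/-- The Goursat quotient `q(U) = p₁(U) / k₁(U)`. -/
abbrev GoursatQuotient {G H : Type*} [Group G] [Group H] (U : Subgroup (G × H)) : Type _ :=
  (p₁ U) ⧸ ((k₁ U).subgroupOf (p₁ U))

/-- `U ≤ G × H` is a subdirect product of `G` and `H`. -/
def IsSubdirect {G H : Type*} [Group G] [Group H] (U : Subgroup (G × H)) : Prop :=
  p₁ U = ⊤ ∧ p₂ U = ⊤

/-- For each prime divisor `p` of `|q(U)|`, the Sylow `p`-subgroups of `q(U)` are cyclic. -/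
def HasCyclicSylows {G H : Type*} [Group G] [Group H] (U : Subgroup (G × H)) : Prop :=
  ∀ p : ℕ, p.Prime → p ∣ Nat.card (GoursatQuotient U) →
    ∀ P : Sylow p (GoursatQuotient U), IsCyclic P

open Classical in
/-- The `π`-part `n_π` of a positive integer `n`. -/
noncomputable def piPart (π : Set ℕ) (n : ℕ) : ℕ :=
  ∏ p ∈ n.primeFactors with p ∈ π, p ^ n.factorization p

/-- The standing hypothesis on the abelian codomain `A`: there is a unique set `π` of primes such
that for every positive integer `n` the `n`-torsion part `{a ∈ A | a ^ n = 1}` of `A` is cyclic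
of order `n_π`. -/
def TorsionHypothesis (A : Type*) [CommGroup A] : Prop :=
  ∃! π : Set ℕ, (∀ p ∈ π, p.Prime) ∧
    ∀ n : ℕ, 0 < n →
      IsCyclic (powMonoidHom n : A →* A).ker ∧
        Nat.card (powMonoidHom n : A →* A).ker = piPart π n

/-- `U ≤ G × H` is `A`-extensible: every homomorphism `U → A` extends to `G × H`. -/
def IsExtensibleTo {G H : Type*} [Group G] [Group H] (U : Subgroup (G × H))
    (A : Type*) [CommGroup A] : Prop :=
  ∀ φ : U →* A, ∃ ψ : G × H →* A, ∀ u : U, ψ (u : G × H) = φ u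

/-- `U ≤ G × H` is extensible: it is `A`-extensible for every abelian group `A` (in an arbitrary
universe `w`) satisfying the standing hypothesis. -/
def IsExtensible.{t, r, s} {G : Type r} {H : Type s} [Group G] [Group H]
    (U : Subgroup (G × H)) : Prop :=
  ∀ (A : Type t) [CommGroup A], TorsionHypothesis A → IsExtensibleTo U A

/-- The `∗`-product of `U ≤ F × G` and `V ≤ G × H`. The conditions `u ∈ p₁(U)`, `v ∈ p₂(V)` and
`x ∈ p₂(U) ∩ p₁(V)` hold automatically when `(u, x) ∈ U` and `(x, v) ∈ V`. -/
def starProduct {F G H : Type*} [Group F] [Group G] [Group H]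
    (U : Subgroup (F × G)) (V : Subgroup (G × H)) : Subgroup (F × H) where
  carrier := {y | ∃ x : G, (y.1, x) ∈ U ∧ (x, y.2) ∈ V}
  one_mem' := ⟨1, U.one_mem, V.one_mem⟩
  mul_mem' := by
    rintro a b ⟨x, hx, hx'⟩ ⟨y, hy, hy'⟩
    exact ⟨x * y, U.mul_mem hx hy, V.mul_mem hx' hy'⟩
  inv_mem' := by
    rintro a ⟨x, hx, hx'⟩
    exact ⟨x⁻¹, U.inv_mem hx, V.inv_mem hx'⟩

end SubdirectExt

namespace SubdirectExt

open scoped commutatorElement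

theorem map_mem_commutator {X Y : Type*} [Group X] [Group Y] (f : X →* Y) {x : X}
    (hx : x ∈ commutator X) : f x ∈ commutator Y := by
  have h := Subgroup.mem_map_of_mem f hx
  rw [commutator_def, Subgroup.map_commutator] at h
  exact Subgroup.commutator_mono le_top le_top h

section SchurMultiplier

/-- If `f : H → Q` has central kernel and the Sylow subgroups of `Q` are cyclic, then `ker f` meets
the commutator subgroup of `H` trivially. -/
theorem ker_inf_commutator_eq_bot {H Q : Type*} [Group H] [Group Q] [Finite H] [IsZGroup Q]
    (f : H →* Q) (hf : Function.Surjective f) (hc : f.ker ≤ Subgroup.center H) :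
    f.ker ⊓ commutator H = ⊥ := by
  have : Finite Q := Finite.of_surjective f hf
  by_contra hne
  have hcard : Nat.card ↥(f.ker ⊓ commutator H) ≠ 1 := by
    rwa [Ne, Subgroup.card_eq_one]
  obtain ⟨p, hp, hdvd⟩ := Nat.exists_prime_and_dvd hcard
  have := Fact.mk hp
  obtain ⟨⟨x, hxm⟩, hx⟩ := exists_prime_orderOf_dvd_card' p hdvd
  obtain ⟨hxk, hxc⟩ := Subgroup.mem_inf.1 hxm
  have hxo : orderOf x = p := by rw [← hx, Subgroup.orderOf_mk]
  have hxZ : ∀ g : H, g * x = x * g := Subgroup.mem_center_iff.1 (hc hxk)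
  let P : Sylow p Q := default
  let K : Subgroup H := (P : Subgroup Q).comap f
  have hK : IsMulCommutative K := by
    have : IsCyclic P := inferInstance
    refine (f.subgroupComap (P : Subgroup Q)).isMulCommutative_of_isCyclic_of_ker_le_center ?_
    intro k hk
    have hk' : (k : H) ∈ f.ker := congrArg Subtype.val hk
    rw [Subgroup.mem_center_iff]
    intro g
    exact Subtype.ext (Subgroup.mem_center_iff.1 (hc hk') g)
  let _ : CommGroup K := { mul_comm := hK.is_comm.comm }
  have hxn : ∀ (k : ℕ) (g : H), g⁻¹ * x ^ k * g = x ^ k := fun k g => by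
    have : Commute g x := hxZ g
    rw [mul_assoc, ← (this.pow_right k).eq, inv_mul_cancel_left]
  have h1 := MonoidHom.transfer_eq_pow (MonoidHom.id K) x fun k g _ => hxn k g
  have h2 : (MonoidHom.transfer (MonoidHom.id K)) x = 1 :=
    Abelianization.commutator_subset_ker _ hxc
  have h3 : x ^ K.index = 1 := congrArg Subtype.val (h1.symm.trans h2)
  have h4 : p ∣ K.index := hxo ▸ orderOf_dvd_of_pow_eq_one h3
  rw [Subgroup.index_comap_of_surjective _ hf] at h4
  exact P.not_dvd_index h4

/-- If `f : G → Q` is surjective and the Sylow subgroups of `Q` are cyclic, then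
`ker f ∩ G' = [ker f, G]`. -/
theorem ker_inf_commutator_le {G Q : Type*} [Group G] [Group Q] [Finite G] [IsZGroup Q]
    (f : G →* Q) (hf : Function.Surjective f) :
    f.ker ⊓ commutator G ≤ ⁅f.ker, (⊤ : Subgroup G)⁆ := by
  let M : Subgroup G := ⁅f.ker, (⊤ : Subgroup G)⁆
  have hM : M ≤ f.ker := Subgroup.commutator_le_left _ _
  let F : G ⧸ M →* Q := QuotientGroup.lift M f hM
  have hF : Function.Surjective F := QuotientGroup.lift_surjective_of_surjective M f hf hM
  have hFc : F.ker ≤ Subgroup.center (G ⧸ M) := by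
    intro y hy
    obtain ⟨x, rfl⟩ := QuotientGroup.mk'_surjective M y
    rw [Subgroup.mem_center_iff]
    intro g
    obtain ⟨g, rfl⟩ := QuotientGroup.mk'_surjective M g
    have hx : x ∈ f.ker := hy
    have h : ⁅x, g⁆ ∈ M := Subgroup.commutator_mem_commutator hx (Subgroup.mem_top g)
    have h' : QuotientGroup.mk' M ⁅x, g⁆ = 1 := (QuotientGroup.eq_one_iff _).2 h
    rw [map_commutatorElement, commutatorElement_eq_one_iff_mul_comm] at h'
    exact h'.symm
  intro x hx
  have h1 : QuotientGroup.mk' M x ∈ F.ker ⊓ commutator (G ⧸ M) :=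
    ⟨hx.1, map_mem_commutator (QuotientGroup.mk' M) hx.2⟩
  rw [ker_inf_commutator_eq_bot F hF hFc, Subgroup.mem_bot] at h1
  exact (QuotientGroup.eq_one_iff _).1 h1

end SchurMultiplier

section Torsion

theorem piPart_mul (π : Set ℕ) {m n : ℕ} (hm : m ≠ 0) (hn : n ≠ 0) :
    piPart π (m * n) = piPart π m * piPart π n := by
  classical
  have key : ∀ {k : ℕ}, k.primeFactors ⊆ (m * n).primeFactors →
      piPart π k = ∏ p ∈ (m * n).primeFactors with p ∈ π, p ^ k.factorization p := by
    intro k hk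
    unfold piPart
    convert Finset.prod_subset (Finset.filter_subset_filter _ hk) ?_ using 1
    intro p hp hpk
    have : p ∉ k.primeFactors := fun h => hpk (Finset.mem_filter.2 ⟨h, (Finset.mem_filter.1 hp).2⟩)
    rw [← Nat.support_factorization, Finsupp.notMem_support_iff] at this
    rw [this, pow_zero]
  have hmul := Nat.primeFactors_mul hm hn
  rw [key (hmul ▸ Finset.subset_union_left : m.primeFactors ⊆ _),
    key (hmul ▸ Finset.subset_union_right : n.primeFactors ⊆ _),
    key subset_rfl, ← Finset.prod_mul_distrib]
  simp only [Nat.factorization_mul hm hn, Finsupp.add_apply, pow_add]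

theorem piPart_pos (π : Set ℕ) (n : ℕ) : 0 < piPart π n := by
  classical
  refine Finset.prod_pos fun p hp => pow_pos ?_ _
  exact (Nat.prime_of_mem_primeFactors (Finset.mem_filter.1 hp).1).pos

/-- Under the standing hypothesis, every torsion element has `n`-th roots. -/
theorem TorsionHypothesis.exists_pow_eq {A : Type*} [CommGroup A] (hA : TorsionHypothesis A)
    {n m : ℕ} (hn : 0 < n) (hm : 0 < m) {a : A} (ha : a ^ m = 1) : ∃ b : A, b ^ n = a := by
  obtain ⟨π, ⟨-, hπ⟩, -⟩ := hA
  have hcard := fun k (hk : 0 < k) => (hπ k hk).2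
  let T : ℕ → Subgroup A := fun k => (powMonoidHom k : A →* A).ker
  have hT : ∀ k x, x ∈ T k ↔ x ^ k = 1 := fun k x => Iff.rfl
  have hfin : ∀ k, 0 < k → Finite (T k) := fun k hk =>
    Nat.finite_of_card_ne_zero (by rw [hcard k hk]; exact (piPart_pos π k).ne')
  have := hfin m hm
  have := hfin (n * m) (Nat.mul_pos hn hm)
  let g : T (n * m) →* A := (powMonoidHom n).comp (T (n * m)).subtype
  have hrange : g.range ≤ T m := by
    rintro _ ⟨⟨x, hx⟩, rfl⟩
    rw [hT] at hx ⊢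
    change (x ^ n) ^ m = 1
    rw [← pow_mul, hx]
  have hker : g.ker = (T n).subgroupOf (T (n * m)) := rfl
  have hle : T n ≤ T (n * m) := fun x hx => by
    rw [hT] at hx ⊢
    rw [pow_mul, hx, one_pow]
  have hkercard : Nat.card g.ker = piPart π n := by
    rw [hker, Nat.card_congr (Subgroup.subgroupOfEquivOfLe hle).toEquiv, hcard n hn]
  have hmul : Nat.card g.ker * Nat.card g.range = Nat.card (T (n * m)) := by
    rw [← Subgroup.index_ker, Subgroup.card_mul_index]
  rw [hkercard, hcard _ (Nat.mul_pos hn hm), piPart_mul π hn.ne' hm.ne'] at hmul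
  have hr : Nat.card g.range = Nat.card (T m) :=
    (Nat.eq_of_mul_eq_mul_left (piPart_pos π n) hmul).trans (hcard m hm).symm
  have heq : g.range = T m := Subgroup.eq_of_le_of_card_ge hrange hr.ge
  obtain ⟨b, hb⟩ : a ∈ g.range := heq ▸ (hT m a).2 ha
  exact ⟨b, hb⟩

/-- Under the standing hypothesis, the torsion subgroup of `A` is an injective abelian group. -/
theorem TorsionHypothesis.baer_torsion {A : Type*} [CommGroup A] (hA : TorsionHypothesis A) :
    Module.Baer ℤ (Additive (CommGroup.torsion A)) := by
  have hroot : ∀ {n : ℕ}, n ≠ 0 → Function.Surjective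
      fun a : Additive (CommGroup.torsion A) => n • a := by
    intro n hn a
    obtain ⟨a, ha⟩ := a
    obtain ⟨m, hm, ham⟩ := isOfFinOrder_iff_pow_eq_one.1 ha
    obtain ⟨b, hb⟩ := hA.exists_pow_eq (Nat.pos_of_ne_zero hn) hm ham
    have hbt : b ∈ CommGroup.torsion A :=
      (isOfFinOrder_pow (n := n)).1 (hb ▸ ha) |>.resolve_right hn
    exact ⟨Additive.ofMul ⟨b, hbt⟩, Subtype.ext hb⟩
  let _ : DivisibleBy (Additive (CommGroup.torsion A)) ℕ :=
    divisibleByOfSMulRightSurj _ ℕ hroot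
  let _ : DivisibleBy (Additive (CommGroup.torsion A)) ℤ :=
    AddGroup.divisibleByIntOfDivisibleByNat _
  exact Module.Baer.of_divisible _

/-- A homomorphism from a subgroup `U` of a finite group `X` to `A` that kills `U ∩ X'` extends
to `X`. -/
theorem TorsionHypothesis.exists_extension {A : Type*} [CommGroup A] (hA : TorsionHypothesis A)
    {X : Type*} [Group X] [Finite X] (U : Subgroup X) (φ : U →* A)
    (hφ : ∀ u : U, (u : X) ∈ commutator X → φ u = 1) :
    ∃ ψ : X →* A, ∀ u : U, ψ u = φ u := by
  let φ' : U →* CommGroup.torsion A :=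
    φ.codRestrict (CommGroup.torsion A) fun u => φ.isOfFinOrder (isOfFinOrder_of_finite u)
  let f : U →* U.map (Abelianization.of (G := X)) := Abelianization.of.subgroupMap U
  have hf : Function.Surjective f := Abelianization.of.subgroupMap_surjective U
  have hker : f.ker ≤ φ'.ker := by
    intro u hu
    have hu' : Abelianization.of (u : X) = 1 := congrArg Subtype.val hu
    refine Subtype.ext (hφ u ?_)
    rwa [← MonoidHom.mem_ker, Abelianization.ker_of] at hu'
  let χ : U.map (Abelianization.of (G := X)) →* CommGroup.torsion A :=
    f.liftOfSurjective hf ⟨φ', hker⟩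
  obtain ⟨h, hh⟩ := hA.baer_torsion.extension_property_addMonoidHom
    (MonoidHom.toAdditive (U.map (Abelianization.of (G := X))).subtype)
    Subtype.val_injective (MonoidHom.toAdditive χ)
  refine ⟨(CommGroup.torsion A).subtype.comp
    ((MonoidHom.toAdditive.symm h).comp Abelianization.of), fun u => ?_⟩
  have h1 : h (Additive.ofMul (Abelianization.of (u : X))) = Additive.ofMul (χ (f u)) :=
    DFunLike.congr_fun hh (Additive.ofMul (f u))
  have h2 : χ (f u) = φ' u := f.liftOfRightInverse_comp_apply _ _ ⟨φ', hker⟩ u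
  change ((Additive.toMul (h (Additive.ofMul (Abelianization.of (u : X)))) : _) : A) = φ u
  rw [h1, h2]
  rfl

end Torsion

section Subdirect

theorem HasCyclicSylows.isZGroup {G H : Type*} [Group G] [Group H] [Finite G]
    {U : Subgroup (G × H)} (hU : HasCyclicSylows U) : IsZGroup (GoursatQuotient U) := by
  refine ⟨fun p hp P => ?_⟩
  have := Fact.mk hp
  by_cases hd : p ∣ Nat.card (GoursatQuotient U)
  · exact hU p hp hd P
  · have hbot : (P : Subgroup (GoursatQuotient U)) = ⊥ := by
      by_contra hne
      obtain ⟨k, hk⟩ := P.2.exists_card_eq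
      have hk0 : k ≠ 0 := fun h0 => hne (Subgroup.card_eq_one.1 (by rw [hk, h0, pow_zero]))
      exact hd (((dvd_pow_self p hk0).trans hk.symm.dvd).trans (Subgroup.card_subgroup_dvd_card _))
    change IsCyclic (P : Subgroup (GoursatQuotient U))
    rw [hbot]
    infer_instance

theorem mem_k₁ {G H : Type*} [Group G] [Group H] {U : Subgroup (G × H)} {g : G} :
    g ∈ k₁ U ↔ (g, (1 : H)) ∈ U :=
  Iff.rfl

theorem mem_p₁ {G H : Type*} [Group G] [Group H] {U : Subgroup (G × H)} {g : G} :
    g ∈ p₁ U ↔ ∃ h : H, (g, h) ∈ U := by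
  simp [p₁]

theorem mem_p₂ {G H : Type*} [Group G] [Group H] {U : Subgroup (G × H)} {h : H} :
    h ∈ p₂ U ↔ ∃ g : G, (g, h) ∈ U := by
  simp [p₂]

/-- In a subdirect product `U` of `G` and `H` with condition (C), `k₁(U) ∩ G'` is contained in
`[k₁(U), G]`. -/
theorem k₁_inf_commutator_le {G H : Type*} [Group G] [Group H] [Finite G]
    {U : Subgroup (G × H)} (h₁ : p₁ U = ⊤) (hC : HasCyclicSylows U) :
    k₁ U ⊓ commutator G ≤ ⁅k₁ U, (⊤ : Subgroup G)⁆ := by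
  have := hC.isZGroup
  let e : G →* p₁ U := (MonoidHom.id G).codRestrict (p₁ U) fun g => h₁ ▸ Subgroup.mem_top g
  let f : G →* GoursatQuotient U := (QuotientGroup.mk' _).comp e
  have hf : Function.Surjective f :=
    (QuotientGroup.mk'_surjective _).comp fun x => ⟨x, rfl⟩
  have hker : f.ker = k₁ U := by
    ext g
    exact QuotientGroup.eq_one_iff (e g)
  simpa only [hker] using ker_inf_commutator_le f hf

/-- In a subdirect product `U` of `G` and `H` with condition (C), every element of `U ∩ (G × H)'`
lies in `U'`. -/
theorem mem_commutator_of_mem_commutator {G H : Type*} [Group G] [Group H] [Finite G]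
    {U : Subgroup (G × H)} (hU : IsSubdirect U) (hC : HasCyclicSylows U)
    {u : U} (hu : (u : G × H) ∈ commutator (G × H)) : u ∈ commutator U := by
  let π₁ : U →* G := (MonoidHom.fst G H).comp U.subtype
  let π₂ : U →* H := (MonoidHom.snd G H).comp U.subtype
  have hπ₂ : Function.Surjective π₂ := fun h => by
    obtain ⟨g, hg⟩ := mem_p₂.1 (hU.2 ▸ Subgroup.mem_top h : h ∈ p₂ U)
    exact ⟨⟨(g, h), hg⟩, rfl⟩
  obtain ⟨v, hv, hvu⟩ : π₂ u ∈ (commutator U).map π₂ := by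
    rw [commutator_def, Subgroup.map_commutator, Subgroup.map_top_of_surjective _ hπ₂]
    exact map_mem_commutator (MonoidHom.snd G H) hu
  have hw : π₁ (u * v⁻¹) ∈ k₁ U ⊓ commutator G := by
    refine ⟨?_, ?_⟩
    · have h2 : (u * v⁻¹ : U).1.2 = 1 := by
        change π₂ (u * v⁻¹) = 1
        rw [map_mul, map_inv, hvu, mul_inv_cancel]
      have h3 : ((π₁ (u * v⁻¹), (1 : H)) : G × H) = (u * v⁻¹ : U) := Prod.ext rfl h2.symm
      exact mem_k₁.2 (h3 ▸ (u * v⁻¹).2)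
    · rw [map_mul, map_inv]
      exact Subgroup.mul_mem _ (map_mem_commutator (MonoidHom.fst G H) hu) (Subgroup.inv_mem _ (map_mem_commutator π₁ hv))
  have hle : ⁅k₁ U, (⊤ : Subgroup G)⁆ ≤
      ((commutator U).map U.subtype).comap (MonoidHom.inl G H) := by
    rw [Subgroup.commutator_le]
    intro n hn g _
    obtain ⟨h, hg⟩ := mem_p₁.1 (hU.1 ▸ Subgroup.mem_top g : g ∈ p₁ U)
    refine ⟨⁅(⟨(n, 1), hn⟩ : U), ⟨(g, h), hg⟩⁆,
      Subgroup.commutator_mem_commutator (Subgroup.mem_top _) (Subgroup.mem_top _), ?_⟩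
    ext <;> simp [commutatorElement_def]
  obtain ⟨w, hw', hwe⟩ := hle (k₁_inf_commutator_le hU.1 hC hw)
  have hwu : w = u * v⁻¹ := by
    refine Subtype.ext (hwe.trans (Prod.ext rfl ?_))
    change 1 = π₂ (u * v⁻¹)
    rw [map_mul, map_inv, hvu, mul_inv_cancel]
  rw [← inv_mul_cancel_right u v, ← hwu]
  exact Subgroup.mul_mem _ hw' hv

/-- A subdirect product of finite groups satisfying condition (C) is extensible. -/
theorem IsSubdirect.isExtensible {G H : Type*} [Group G] [Group H] [Finite G] [Finite H]
    {U : Subgroup (G × H)} (hU : IsSubdirect U) (hC : HasCyclicSylows U) :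
    IsExtensible.{w} U := fun _ _ hA φ =>
  hA.exists_extension U φ fun _ hu =>
    Abelianization.commutator_subset_ker φ (mem_commutator_of_mem_commutator hU hC hu)

theorem IsSubdirect.starProduct {F G H : Type*} [Group F] [Group G] [Group H]
    {U : Subgroup (F × G)} {V : Subgroup (G × H)} (hU : IsSubdirect U) (hV : IsSubdirect V) :
    IsSubdirect (starProduct U V) := by
  refine ⟨eq_top_iff.2 fun f _ => ?_, eq_top_iff.2 fun h _ => ?_⟩
  · obtain ⟨x, hx⟩ := mem_p₁.1 (hU.1 ▸ Subgroup.mem_top f : f ∈ p₁ U)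
    obtain ⟨h, hh⟩ := mem_p₁.1 (hV.1 ▸ Subgroup.mem_top x : x ∈ p₁ V)
    exact mem_p₁.2 ⟨h, x, hx, hh⟩
  · obtain ⟨x, hx⟩ := mem_p₂.1 (hV.2 ▸ Subgroup.mem_top h : h ∈ p₂ V)
    obtain ⟨f, hf⟩ := mem_p₂.1 (hU.2 ▸ Subgroup.mem_top x : x ∈ p₂ U)
    exact mem_p₂.2 ⟨f, x, hf, hx⟩

/-- `q(U ∗ V)` is a quotient of a subgroup of `q(U)`, hence inherits condition (C). -/
theorem HasCyclicSylows.starProduct {F G H : Type*} [Group F] [Group G] [Group H] [Finite F]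
    {U : Subgroup (F × G)} (hU : HasCyclicSylows U) (V : Subgroup (G × H)) :
    HasCyclicSylows (starProduct U V) := by
  have := hU.isZGroup
  set W := SubdirectExt.starProduct U V
  have hp : p₁ W ≤ p₁ U := fun f hf => by
    obtain ⟨h, x, hx, -⟩ := mem_p₁.1 hf
    exact mem_p₁.2 ⟨x, hx⟩
  have hk : k₁ U ≤ k₁ W := fun f hf => ⟨1, hf, V.one_mem⟩
  let i : p₁ W →* GoursatQuotient U := (QuotientGroup.mk' _).comp (Subgroup.inclusion hp)
  have : IsZGroup (p₁ W ⧸ i.ker) := IsZGroup.of_injective (QuotientGroup.kerLift_injective i)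
  have hker : i.ker ≤ (k₁ W).subgroupOf (p₁ W) := fun f hf =>
    hk ((QuotientGroup.eq_one_iff (Subgroup.inclusion hp f)).1 hf)
  let j : p₁ W ⧸ i.ker →* GoursatQuotient W :=
    QuotientGroup.lift i.ker (QuotientGroup.mk' _) (by rwa [QuotientGroup.ker_mk'])
  have hj : Function.Surjective j :=
    QuotientGroup.lift_surjective_of_surjective _ _ (QuotientGroup.mk'_surjective _) _
  have := IsZGroup.of_surjective hj
  intro p hp _ P
  exact IsZGroup.isZGroup p hp P

end Subdirect

end SubdirectExt

theorem mainTheorem3 {F G H : Type*} [Group F] [Group G] [Group H]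
    [Finite F] [Finite G] [Finite H]
    (U : Subgroup (F × G)) (V : Subgroup (G × H)) :
    (SubdirectExt.IsSubdirect U → SubdirectExt.HasCyclicSylows U →
      SubdirectExt.IsExtensible.{w} U) ∧
    (SubdirectExt.HasCyclicSylows U → SubdirectExt.HasCyclicSylows V →
      SubdirectExt.HasCyclicSylows (SubdirectExt.starProduct U V)) ∧
    (SubdirectExt.IsSubdirect U → SubdirectExt.IsSubdirect V →
      SubdirectExt.IsSubdirect (SubdirectExt.starProduct U V)) :=
  ⟨fun hU hC => hU.isExtensible hC, fun hU _ => hU.starProduct V,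
    fun hU hV => hU.starProduct hV⟩
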